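/- Let $H\in(0,1)$ and $\kappa\in(0,\infty)$. Let $B^H=\{B^H_t\}_{t\ge 0}$ be a fractional Brownian motion with Hurst index $H$, i.e. a centered Gaussian process with continuous sample paths and covariance $\mathrm{Cov}(B^H_s,B^H_t)=\tfrac12\,(s^{2H}+t^{2H}-|s-t|^{2H})$ for $s,t\ge 0$. Let $\{(\eta_i,U_i)\}_{i\in\mathbb N}$ be a Poisson point process on $[0,\infty)\times[0,\infty)$ with intensity measure $H^{-1}x^{-1-1/H}\,dx\,du$, defined on the same probability space as $B^H$ and independent of $B^H$. Define $$Z^H_t=\sup_{s\in[0,t]}\Big(B^H_s+\kappa^H\sum_{i}\eta_i\mathbf 1_{\{U_i=s\}}\Big),\qquad t\ge 0.$$ Then, for all $0=t_0<t_1<\dots<t_d<\infty$ and $x_1,\dots,x_d\in\mathbb R$, $$\mathbb P\big(Z^H_{t_1}\le x_1,\dots,Z^H_{t_d}\le x_d\big)=\mathbb E\exp\Big\{-\sum_{q=1}^d\int_{t_{q-1}}^{t_q}\frac{\kappa}{\big(\min_{q\le j\le d}x_j-B^H_t\big)_+^{1/H}}\,dt\Big\},$$ where $y_+=\max(y,0)$,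 $\kappa/0=\infty$ and $\exp(-\infty)=0$. Moreover, $Z^H$ is $H$-self-similar: for every $a>0$, the processes $\{Z^H_{at}\}_{t\ge 0}$ and $\{a^HZ^H_t\}_{t\ge 0}$ have the same law (the same finite-dimensional distributions). -/

import Mathlib

open MeasureTheory ProbabilityTheory
open scoped NNReal ENNReal

/-- A fractional Brownian motion on `[0, ∞)` with Hurst index `H`: a centered Gaussian process with
covariance `(s ^ (2H) + t ^ (2H) - |s - t| ^ (2H)) / 2` and (almost surely) continuous sample
paths. -/
structure IsFractionalBrownianMotion {Ω : Type*} [MeasurableSpace Ω]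
    (H : ℝ) (B : ℝ≥0 → Ω → ℝ) (P : Measure Ω) : Prop where
  measurable : ∀ t, Measurable (B t)
  gaussian : IsGaussianProcess B P
  centered : ∀ t, ∫ ω, B t ω ∂P = 0
  cov : ∀ s t : ℝ≥0, covariance (B s) (B t) P =
    ((s : ℝ) ^ (2 * H) + (t : ℝ) ^ (2 * H) - |(s : ℝ) - (t : ℝ)| ^ (2 * H)) / 2
  continuous_paths : ∀ᵐ ω ∂P, Continuous fun t => B t ω

/-- The random counting measure `∑ᵢ δ_{ξᵢ}` of a sequence of random points
(points are counted with multiplicity). -/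
noncomputable def countingMeasure {Ω E : Type*} [MeasurableSpace E]
    (ξ : ℕ → Ω → E) (ω : Ω) : Measure E :=
  Measure.sum fun i => Measure.dirac (ξ i ω)

/-- The random points `ξ₀, ξ₁, …` form a Poisson point process with intensity measure `μ`:
the number of points in a measurable set `A` is Poisson distributed with parameter `μ A`
(and is almost surely infinite if `μ A = ∞`), and the numbers of points in finitely many
pairwise disjoint measurable sets are independent. -/
structure IsPoissonPointProcess {Ω E : Type*} [MeasurableSpace Ω] [MeasurableSpace E]
    (ξ : ℕ → Ω → E) (μ : Measure E) (P : Measure Ω) : Prop where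
  measurable : ∀ i, Measurable (ξ i)
  law : ∀ A : Set E, MeasurableSet A → μ A ≠ ∞ →
    HasLaw (fun ω => countingMeasure ξ ω A)
      ((poissonMeasure (μ A).toNNReal).map (fun n : ℕ => (n : ℝ≥0∞))) P
  law_top : ∀ A : Set E, MeasurableSet A → μ A = ∞ → ∀ᵐ ω ∂P, countingMeasure ξ ω A = ∞
  indep : ∀ (n : ℕ) (A : Fin n → Set E), (∀ k, MeasurableSet (A k)) →
    Pairwise (fun k l => Disjoint (A k) (A l)) →
    iIndepFun (fun k ω => countingMeasure ξ ω (A k)) P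

/-- Lebesgue measure on `[0, ∞)`. -/
noncomputable def lebesgueHalfLine : Measure ℝ≥0 :=
  (volume : Measure ℝ).comap fun x : ℝ≥0 => (x : ℝ)

/-- The intensity measure `H⁻¹ x ^ (-1 - 1/H) dx du` on `[0, ∞) × [0, ∞)`. -/
noncomputable def shotNoiseIntensity (H : ℝ) : Measure (ℝ≥0 × ℝ≥0) :=
  (lebesgueHalfLine.withDensity
    fun x => ENNReal.ofReal (H⁻¹ * (x : ℝ) ^ (-1 - 1 / H))).prod lebesgueHalfLine

/-- The maximum process of `B` with shot noise:
`Z_t = sup_{s ∈ [0, t]} (B_s + κ ^ H * ∑ᵢ ηᵢ 1{Uᵢ = s})`. The sum is taken in `[0, ∞]` and the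
supremum in the extended reals, so that no convention for divergent expressions intervenes. -/
noncomputable def maxShotNoise {Ω : Type*} (H κ : ℝ) (B : ℝ≥0 → Ω → ℝ)
    (η U : ℕ → Ω → ℝ≥0) (t : ℝ≥0) (ω : Ω) : EReal :=
  ⨆ s ∈ Set.Icc 0 t, ((B s ω : ℝ) : EReal) +
    ((ENNReal.ofReal (κ ^ H) * ∑' i, (if U i ω = s then (η i ω : ℝ≥0∞) else 0) : ℝ≥0∞) : EReal)

/-! ### Void probabilities of a Poisson process, also for random sets -/

section PoissonPointProcess

variable {Ω E : Type*} [MeasurableSpace Ω] [MeasurableSpace E] {ξ : ℕ → Ω → E} {μ : Measure E}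
  {P : Measure Ω}

/-! Almost surely the shot times `U i` are pairwise distinct and dense, so at a shot time the sum in
`maxShotNoise` is a single mark, and by continuity of `B` the other times add nothing beyond the
value `B 0`. Hence `Z_{t_i} ≤ x_i` for all `i` says that, apart from a condition on `B 0`, no
Poisson point lies in a set determined by the path of `B` (`maxShotNoise_le_iff`, `exceedanceSet`).

Since the point process is independent of `B`, the path can be frozen, and the conditional void
probability is exp(-intensity of that set) (`measure_random_set_eq_zero`). Slicing the set in time
and using that marks above `c` have intensity `c ^ (-1/H)` turns the exponent into the stated
integrals (`shotNoiseIntensity_exceedanceSet`).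

Self-similarity holds because the intensity is invariant under `(y, u) ↦ (a ^ H * y, a * u)`
(`map_shotNoiseIntensity`) while `B` has the matching scaling in law. The void formula transfers
both to the joint distribution functions of `Z`. -/

omit [MeasurableSpace Ω] in
theorem countingMeasure_apply (ξ : ℕ → Ω → E) (ω : Ω) {A : Set E} (hA : MeasurableSet A) :
    countingMeasure ξ ω A = ∑' i, A.indicator 1 (ξ i ω) := by
  simp [countingMeasure, Measure.sum_apply _ hA, Measure.dirac_apply' _ hA]

omit [MeasurableSpace Ω] in
theorem countingMeasure_eq_zero_iff (ξ : ℕ → Ω → E) (ω : Ω) {A : Set E} (hA : MeasurableSet A) :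
    countingMeasure ξ ω A = 0 ↔ ∀ i, ξ i ω ∉ A := by
  simp [countingMeasure_apply ξ ω hA, ENNReal.tsum_eq_zero]

omit [MeasurableSpace Ω] in
theorem two_le_countingMeasure (ξ : ℕ → Ω → E) (ω : Ω) {A : Set E} (hA : MeasurableSet A)
    {i j : ℕ} (hij : i ≠ j) (hi : ξ i ω ∈ A) (hj : ξ j ω ∈ A) : 2 ≤ countingMeasure ξ ω A := by
  rw [countingMeasure_apply ξ ω hA]
  refine le_trans ?_ (ENNReal.sum_le_tsum {i, j})
  rw [Finset.sum_pair hij]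
  simp [hi, hj, one_add_one_eq_two]

theorem measurable_countingMeasure (hξ : ∀ i, Measurable (ξ i)) :
    Measurable fun ω => countingMeasure ξ ω := by
  refine Measure.measurable_of_measurable_coe _ fun A hA => ?_
  simp_rw [countingMeasure_apply ξ _ hA]
  exact Measurable.tsum fun i => (measurable_one.indicator hA).comp (hξ i)

namespace IsPoissonPointProcess

variable (hN : IsPoissonPointProcess ξ μ P)
include hN

theorem measurable_apply {A : Set E} (hA : MeasurableSet A) :
    Measurable fun ω => countingMeasure ξ ω A :=
  (Measure.measurable_coe hA).comp (measurable_countingMeasure hN.measurable)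

theorem measure_eq_zero [IsProbabilityMeasure P] {A : Set E} (hA : MeasurableSet A) :
    P {ω | countingMeasure ξ ω A = 0} = EReal.exp (-(μ A : EReal)) := by
  by_cases h : μ A = ∞
  · have h1 : P {ω | countingMeasure ξ ω A = 0} = 0 := by
      refine measure_mono_null ?_ (ae_iff.1 (hN.law_top A hA h))
      intro ω hω
      simp only [Set.mem_ofPred_eq] at hω ⊢
      simp [hω]
    simp [h1, h]
  · have hm : MeasurableSet {x : ℝ≥0∞ | x = 0} := by simp
    rw [(hN.law A hA h).measure_eq hm, Measure.map_apply (measurable_of_countable _) hm]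
    have : (fun n : ℕ => (n : ℝ≥0∞)) ⁻¹' {x | x = 0} = {0} := by ext; simp
    rw [this, poissonMeasure_singleton]
    lift μ A to ℝ≥0 using h with m
    simp only [ENNReal.toNNReal_coe, pow_zero, Nat.factorial_zero]
    have hcoe : -((m : ℝ≥0∞) : EReal) = ((-(m : ℝ) : ℝ) : EReal) := rfl
    rw [hcoe, EReal.exp_coe]
    simp

theorem ae_forall_notMem [IsProbabilityMeasure P] {A : Set E} (hA : MeasurableSet A)
    (h : μ A = 0) : ∀ᵐ ω ∂P, ∀ i, ξ i ω ∉ A := by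
  have h1 := hN.measure_eq_zero hA
  rw [h] at h1
  simp only [EReal.coe_ennreal_zero, neg_zero, EReal.exp_zero] at h1
  have := (prob_compl_eq_zero_iff (measurableSet_eq_fun (hN.measurable_apply hA) measurable_const)).2 h1
  refine measure_mono_null ?_ this
  intro ω hω h2
  exact hω ((countingMeasure_eq_zero_iff ξ ω hA).1 h2)

/-- With `m = μ A` finite, the probability is `1 - (1 + m) * exp (-m)`, and `exp (-m) ≥ 1 - m`
bounds it by `m ^ 2`. The quadratic order is what excludes simultaneous points. -/
theorem measure_two_le [IsProbabilityMeasure P] {A : Set E} (hA : MeasurableSet A) :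
    P {ω | 2 ≤ countingMeasure ξ ω A} ≤ μ A ^ 2 := by
  by_cases h : μ A = ∞
  · simp [h]
  have hm : MeasurableSet {x : ℝ≥0∞ | 2 ≤ x} := measurableSet_Ici
  rw [(hN.law A hA h).measure_eq hm, Measure.map_apply (measurable_of_countable _) hm]
  have : (fun n : ℕ => (n : ℝ≥0∞)) ⁻¹' {x | 2 ≤ x} = ({0, 1} : Set ℕ)ᶜ := by
    ext n
    simp only [Set.mem_preimage, Set.mem_ofPred_eq, Set.mem_compl_iff, Set.mem_insert_iff,
      Set.mem_singleton_iff]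
    rw [← Nat.cast_ofNat, Nat.cast_le]
    omega
  lift μ A to ℝ≥0 using h with m
  rw [this, ← ofReal_measureReal, measureReal_compl (by measurability),
    Set.insert_eq, measureReal_union (by simp) (by measurability), poissonMeasure_real_singleton,
    poissonMeasure_real_singleton]
  rw [← ENNReal.ofReal_coe_nnreal, ← ENNReal.ofReal_pow (by positivity)]
  apply ENNReal.ofReal_le_ofReal
  have := Real.add_one_le_exp (-(m : ℝ))
  simp
  nlinarith [m.2]

end IsPoissonPointProcess

open scoped Classical in
/-- The s-finite kernel that maps a measure `ν` to a sum of restrictions of `ν` to sets of finite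
`ν`-measure of an increasing sequence of sets. -/
noncomputable def restrictionKernel (S : ℕ → Set E) (hS : ∀ k, MeasurableSet (S k)) :
    Kernel (Measure E) E :=
  Kernel.sum fun p : ℕ × ℕ =>
    Kernel.piecewise (measurableSet_Iic.preimage (Measure.measurable_coe (hS p.1)) :
      MeasurableSet {ν : Measure E | ν (S p.1) ≤ p.2})
      (Kernel.restrict ⟨id, measurable_id⟩ (hS p.1)) 0

open scoped Classical in
instance (S : ℕ → Set E) (hS : ∀ k, MeasurableSet (S k)) :
    IsSFiniteKernel (restrictionKernel S hS) := by
  unfold restrictionKernel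
  refine @Kernel.isSFiniteKernel_sum _ _ _ _ _ _ _ fun p => ?_
  have : IsFiniteKernel (Kernel.piecewise
      (measurableSet_Iic.preimage (Measure.measurable_coe (hS p.1)) :
        MeasurableSet {ν : Measure E | ν (S p.1) ≤ p.2})
      (Kernel.restrict ⟨id, measurable_id⟩ (hS p.1)) 0) := by
    refine ⟨⟨p.2, ENNReal.natCast_lt_top _, fun ν => ?_⟩⟩
    rw [Kernel.piecewise_apply]
    split_ifs with h
    · simpa [Kernel.restrict_apply] using h
    · simp
  infer_instance

/-- Each `S k` is counted once for every `n ≥ ν (S k)`, so the kernel does not reproduce `ν`; it has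
the same null sets, which is all that void events see. In exchange it is s-finite, which makes its
value on the sections of a measurable set jointly measurable. -/
theorem restrictionKernel_eq_zero_iff (S : ℕ → Set E) (hS : ∀ k, MeasurableSet (S k))
    {ν : Measure E} (hν : ∀ k, ν (S k) ≠ ∞) (hU : ⋃ k, S k = Set.univ) {A : Set E}
    (hA : MeasurableSet A) : restrictionKernel S hS ν A = 0 ↔ ν A = 0 := by
  rw [restrictionKernel, Kernel.sum_apply' _ _ hA, ENNReal.tsum_eq_zero]
  simp only [Kernel.piecewise_apply', Kernel.restrict_apply' _ _ _ hA]
  constructor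
  · intro h
    rw [← Set.inter_univ A, ← hU, Set.inter_iUnion, measure_iUnion_null_iff]
    intro k
    obtain ⟨n, hn⟩ := ENNReal.exists_nat_gt (hν k)
    have := h (k, n)
    rw [if_pos (by exact hn.le)] at this
    exact this
  · intro h p
    split_ifs
    · exact measure_mono_null Set.inter_subset_left h
    · simp

/-- By independence the pair (counting measure, `X`) has a product law; Fubini freezes `X`, and the
void probability of a deterministic set applies. The difficulty is joint measurability of the void
event, obtained by replacing the counting measure with `restrictionKernel`. -/
theorem IsPoissonPointProcess.measure_random_set_eq_zero [IsProbabilityMeasure P] [SigmaFinite μ]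
    (hN : IsPoissonPointProcess ξ μ P) {F : Type*} [MeasurableSpace F] {X : Ω → F}
    (hX : Measurable X) (hindep : IndepFun (fun ω => countingMeasure ξ ω) X P)
    {A : Set (F × E)} (hA : MeasurableSet A) {G : Set F} (hG : MeasurableSet G) :
    P {ω | X ω ∈ G ∧ countingMeasure ξ ω (Prod.mk (X ω) ⁻¹' A) = 0} =
      ∫⁻ ω in X ⁻¹' G, EReal.exp (-(μ (Prod.mk (X ω) ⁻¹' A) : EReal)) ∂P := by
  have hNm := measurable_countingMeasure hN.measurable
  set K := restrictionKernel (spanningSets μ) (measurableSet_spanningSets μ) with hK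
  have hfin : ∀ᵐ ω ∂P, ∀ k, countingMeasure ξ ω (spanningSets μ k) ≠ ∞ := by
    rw [ae_all_iff]
    intro k
    have hl := hN.law _ (measurableSet_spanningSets μ k) (measure_spanningSets_lt_top μ k).ne
    rw [hl.ae_iff (p := fun x => x ≠ ∞) (by measurability)]
    rw [ae_map_iff (measurable_of_countable _).aemeasurable (by measurability)]
    simp
  have key : ∀ᵐ ω ∂P, ∀ C : Set E, MeasurableSet C →
      (K (countingMeasure ξ ω) C = 0 ↔ countingMeasure ξ ω C = 0) := by
    filter_upwards [hfin] with ω hω C hC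
    exact restrictionKernel_eq_zero_iff _ _ hω (iUnion_spanningSets μ) hC
  have hAs (b : F) : MeasurableSet (Prod.mk b ⁻¹' A) := measurable_prodMk_left hA
  set S : Set (Measure E × F) := {p | p.2 ∈ G ∧ K p.1 (Prod.mk p.2 ⁻¹' A) = 0} with hSdef
  have hS : MeasurableSet S := by
    refine (measurable_snd hG).inter ?_
    have h1 : MeasurableSet {q : (Measure E × F) × E | (q.1.2, q.2) ∈ A} :=
      ((measurable_snd.comp measurable_fst).prodMk measurable_snd) hA
    have := Kernel.measurable_kernel_prodMk_left (κ := K.comap Prod.fst measurable_fst) h1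
    exact measurableSet_eq_fun (f := fun p : Measure E × F => K p.1 (Prod.mk p.2 ⁻¹' A)) this
      measurable_const
  have h1 : P {ω | X ω ∈ G ∧ countingMeasure ξ ω (Prod.mk (X ω) ⁻¹' A) = 0} =
      P.map (fun ω => (countingMeasure ξ ω, X ω)) S := by
    rw [Measure.map_apply (hNm.prodMk hX) hS]
    refine measure_congr ?_
    filter_upwards [key] with ω hω
    have := hω _ (hAs (X ω))
    apply propext
    change (_ ∧ _) ↔ (_ ∧ _)
    rw [this]
  rw [h1, hindep.map_prod_eq_prod_map_map hNm.aemeasurable hX.aemeasurable]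
  have := Measure.isProbabilityMeasure_map (μ := P) hX.aemeasurable
  have := Measure.isProbabilityMeasure_map (μ := P) hNm.aemeasurable
  rw [Measure.prod_apply_symm hS, lintegral_map (measurable_measure_prodMk_right hS) hX,
    ← lintegral_indicator (hX hG)]
  refine lintegral_congr fun ω => ?_
  have hm : MeasurableSet ((fun ν : Measure E => (ν, X ω)) ⁻¹' S) := measurable_prodMk_right hS
  rw [Measure.map_apply hNm hm]
  by_cases hω : X ω ∈ G
  · rw [Set.indicator_of_mem (by exact hω), ← hN.measure_eq_zero (hAs (X ω))]
    refine measure_congr ?_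
    filter_upwards [key] with ω' hω'
    have := hω' _ (hAs (X ω))
    apply propext
    change (_ ∧ _) ↔ _
    simp only [hω, true_and]
    exact this
  · rw [Set.indicator_of_notMem (by exact hω)]
    refine measure_mono_null (t := ∅) ?_ measure_empty
    intro ω' h
    exact hω h.1

end PoissonPointProcess

/-! ### Lebesgue measure on the half-line -/

section HalfLine

theorem measurableEmbedding_nnrealCoe : MeasurableEmbedding ((↑) : ℝ≥0 → ℝ) :=
  MeasurableEmbedding.subtype_coe measurableSet_Ici

theorem lebesgueHalfLine_apply (A : Set ℝ≥0) :
    lebesgueHalfLine A = volume (((↑) : ℝ≥0 → ℝ) '' A) :=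
  measurableEmbedding_nnrealCoe.comap_apply _ _

theorem map_coe_lebesgueHalfLine :
    lebesgueHalfLine.map ((↑) : ℝ≥0 → ℝ) = volume.restrict (Set.Ici 0) := by
  rw [lebesgueHalfLine, measurableEmbedding_nnrealCoe.map_comap, NNReal.range_coe]

instance : SigmaFinite lebesgueHalfLine := by
  refine SigmaFinite.of_map _ measurableEmbedding_nnrealCoe.measurable.aemeasurable ?_
  rw [map_coe_lebesgueHalfLine]
  infer_instance

theorem lebesgueHalfLine_Ioc (a b : ℝ≥0) :
    lebesgueHalfLine (Set.Ioc a b) = ENNReal.ofReal (b - a) := by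
  have : ((↑) : ℝ≥0 → ℝ) '' Set.Ioc a b = Set.Ioc (a : ℝ) b := by
    ext x
    constructor
    · rintro ⟨y, hy, rfl⟩
      exact hy
    · intro hx
      exact ⟨⟨x, a.2.trans hx.1.le⟩, hx, rfl⟩
  rw [lebesgueHalfLine_apply, this, Real.volume_Ioc]

theorem lebesgueHalfLine_Ico (a b : ℝ≥0) :
    lebesgueHalfLine (Set.Ico a b) = ENNReal.ofReal (b - a) := by
  have : ((↑) : ℝ≥0 → ℝ) '' Set.Ico a b = Set.Ico (a : ℝ) b := by
    ext x
    constructor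
    · rintro ⟨y, hy, rfl⟩
      exact hy
    · intro hx
      exact ⟨⟨x, a.2.trans hx.1⟩, hx, rfl⟩
  rw [lebesgueHalfLine_apply, this, Real.volume_Ico]

theorem lebesgueHalfLine_singleton (a : ℝ≥0) : lebesgueHalfLine {a} = 0 := by
  rw [lebesgueHalfLine_apply]
  simp

theorem map_mul_lebesgueHalfLine {a : ℝ≥0} (ha : a ≠ 0) :
    lebesgueHalfLine.map (fun u => a * u) = (a⁻¹ : ℝ≥0) • lebesgueHalfLine := by
  ext A hA
  rw [Measure.map_apply (by fun_prop) hA, Measure.smul_apply, lebesgueHalfLine_apply,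
    lebesgueHalfLine_apply]
  have : ((↑) : ℝ≥0 → ℝ) '' ((fun u => a * u) ⁻¹' A) =
      ((a : ℝ) * ·) ⁻¹' (((↑) : ℝ≥0 → ℝ) '' A) := by
    ext x
    simp only [Set.mem_image, Set.mem_preimage]
    constructor
    · rintro ⟨y, hy, rfl⟩
      exact ⟨_, hy, by simp⟩
    · rintro ⟨y, hy, h⟩
      have ha' : (a : ℝ) ≠ 0 := by exact_mod_cast ha
      refine ⟨a⁻¹ * y, by simpa [ha] using hy, ?_⟩
      rw [NNReal.coe_mul, h, NNReal.coe_inv, inv_mul_cancel_left₀ ha']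
  rw [this, Real.volume_preimage_mul_left (by exact_mod_cast ha), abs_of_nonneg (by positivity),
    ← NNReal.coe_inv, ENNReal.ofReal_coe_nnreal]
  rfl

end HalfLine

/-! ### Tails and scaling of the intensity -/

section MarkIntensity

/-- The intensity `H⁻¹ x ^ (-1 - 1/H) dx` of the marks of the shot noise. -/
noncomputable def markIntensity (H : ℝ) : Measure ℝ≥0 :=
  lebesgueHalfLine.withDensity fun x => ENNReal.ofReal (H⁻¹ * (x : ℝ) ^ (-1 - 1 / H))

theorem shotNoiseIntensity_eq (H : ℝ) :
    shotNoiseIntensity H = (markIntensity H).prod lebesgueHalfLine := rfl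

instance (H : ℝ) : SigmaFinite (markIntensity H) := SigmaFinite.withDensity_ofReal _

instance (H : ℝ) : SigmaFinite (shotNoiseIntensity H) := by
  rw [shotNoiseIntensity_eq]
  infer_instance

theorem measurable_markDensity (H : ℝ) :
    Measurable fun x : ℝ≥0 => ENNReal.ofReal (H⁻¹ * (x : ℝ) ^ (-1 - 1 / H)) := by
  fun_prop

variable {H : ℝ} (hH : 0 < H)
include hH

theorem markIntensity_Ioi_of_pos {c : ℝ≥0} (hc : 0 < c) :
    markIntensity H (Set.Ioi c) = ENNReal.ofReal ((c : ℝ) ^ (-(1 / H))) := by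
  have hH' : 0 < 1 / H := by positivity
  have hc' : (0 : ℝ) < c := hc
  have hlt : -1 - 1 / H < -1 := by linarith
  rw [markIntensity, withDensity_apply _ measurableSet_Ioi]
  have h1 : ((↑) : ℝ≥0 → ℝ) ⁻¹' Set.Ioi (c : ℝ) = Set.Ioi c := by
    ext; simp
  rw [← h1, ← setLIntegral_map (f := fun x : ℝ => ENNReal.ofReal (H⁻¹ * x ^ (-1 - 1 / H)))
    measurableSet_Ioi (by fun_prop) measurableEmbedding_nnrealCoe.measurable,
    map_coe_lebesgueHalfLine, Measure.restrict_restrict measurableSet_Ioi,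
    Set.inter_eq_left.2 (Set.Ioi_subset_Ici hc'.le),
    ← ofReal_integral_eq_lintegral_ofReal ((integrableOn_Ioi_rpow_of_lt hlt hc').const_mul _),
    integral_const_mul, integral_Ioi_rpow_of_lt hlt hc']
  · congr 1
    have : -1 - 1 / H + 1 = -(1 / H) := by ring
    rw [this]
    field_simp
  · filter_upwards [ae_restrict_mem measurableSet_Ioi] with x hx
    have : 0 < x := hc'.trans hx
    simp only [Pi.zero_apply]
    positivity

theorem markIntensity_Ioi_zero : markIntensity H (Set.Ioi 0) = ∞ := by
  refine ENNReal.eq_top_of_forall_nnreal_le fun r => ?_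
  have hr : 0 < r + 1 := by positivity
  have hε : 0 < (r + 1) ^ (-H) := NNReal.rpow_pos hr
  refine le_trans ?_ (measure_mono (Set.Ioi_subset_Ioi hε.le))
  rw [markIntensity_Ioi_of_pos hH hε, NNReal.coe_rpow, ← Real.rpow_mul (by positivity)]
  have : -H * -(1 / H) = 1 := by field_simp
  rw [this, Real.rpow_one, ENNReal.ofReal_coe_nnreal]
  exact_mod_cast le_self_add

theorem markIntensity_univ : markIntensity H Set.univ = ∞ :=
  top_le_iff.1 ((markIntensity_Ioi_zero hH).symm.le.trans (measure_mono (Set.subset_univ _)))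

theorem markIntensity_Ioi (c : ℝ≥0) :
    markIntensity H (Set.Ioi c) = 1 / (c : ℝ≥0∞) ^ (1 / H) := by
  rcases eq_or_ne c 0 with rfl | hc
  · simp [markIntensity_Ioi_zero hH, hH]
  · have hc' : 0 < c := pos_iff_ne_zero.2 hc
    rw [markIntensity_Ioi_of_pos hH hc', ← ENNReal.ofReal_rpow_of_pos (by exact_mod_cast hc'),
      ENNReal.ofReal_coe_nnreal, ENNReal.rpow_neg, one_div, one_div]

omit hH in
theorem markIntensity_singleton (a : ℝ≥0) : markIntensity H {a} = 0 :=
  withDensity_absolutelyContinuous _ _ (lebesgueHalfLine_singleton a)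

/-- With `c = a ^ H`, homogeneity of the density gives the factor `c ^ (1 + 1/H)` and the change of
variables gives `c⁻¹`; their product is `c ^ (1/H) = a`. -/
theorem map_mul_markIntensity {a : ℝ≥0} (ha : a ≠ 0) :
    (markIntensity H).map (fun y => a ^ H * y) = a • markIntensity H := by
  ext A hA
  have hc : a ^ H ≠ 0 := by simp [ha]
  set c := a ^ H with hcdef
  have hc0 : (0 : ℝ) < c := by exact_mod_cast pos_iff_ne_zero.2 hc
  have hm : Measurable fun y : ℝ≥0 => c * y := by fun_prop
  set f : ℝ≥0 → ℝ≥0∞ := fun x => ENNReal.ofReal (H⁻¹ * (x : ℝ) ^ (-1 - 1 / H)) with hf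
  have hfm : Measurable f := measurable_markDensity H
  have hfc (x : ℝ≥0) : f x = ENNReal.ofReal ((c : ℝ) ^ (1 + 1 / H)) * f (c * x) := by
    simp only [hf]
    rw [← ENNReal.ofReal_mul (by positivity), NNReal.coe_mul,
      Real.mul_rpow hc0.le x.coe_nonneg]
    congr 1
    have : (c : ℝ) ^ (1 + 1 / H) * (c : ℝ) ^ (-1 - 1 / H) = 1 := by
      rw [← Real.rpow_add hc0]
      ring_nf
      exact Real.rpow_zero _
    linear_combination -(H⁻¹ * (x : ℝ) ^ (-1 - 1 / H)) * this
  rw [Measure.map_apply hm hA, markIntensity, Measure.smul_apply,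
    withDensity_apply _ (hm hA), withDensity_apply _ hA, ← lintegral_indicator (hm hA),
    ← lintegral_indicator hA]
  have hind (x : ℝ≥0) : ((fun y => c * y) ⁻¹' A).indicator f x =
      ENNReal.ofReal ((c : ℝ) ^ (1 + 1 / H)) * A.indicator f (c * x) := by
    by_cases hx : c * x ∈ A
    · rw [Set.indicator_of_mem (by exact hx), Set.indicator_of_mem hx, hfc]
    · rw [Set.indicator_of_notMem (by exact hx), Set.indicator_of_notMem hx, mul_zero]
  refine (lintegral_congr hind).trans ?_
  refine (lintegral_const_mul _ ((hfm.indicator hA).comp hm)).trans ?_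
  refine (congrArg _ (lintegral_map (hfm.indicator hA) hm).symm).trans ?_
  rw [map_mul_lebesgueHalfLine hc, lintegral_smul_measure]
  change _ * (((c⁻¹ : ℝ≥0) : ℝ≥0∞) * _) = (a : ℝ≥0∞) * _
  rw [← mul_assoc]
  congr 1
  rw [← ENNReal.ofReal_coe_nnreal, ← ENNReal.ofReal_coe_nnreal (p := a),
    ← ENNReal.ofReal_mul (by positivity)]
  congr 1
  have hca : (c : ℝ) ^ (1 / H) = a := by
    rw [hcdef, NNReal.coe_rpow, ← Real.rpow_mul a.coe_nonneg, mul_one_div_cancel hH.ne',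
      Real.rpow_one]
  rw [Real.rpow_add hc0, hca, Real.rpow_one, NNReal.coe_inv]
  field_simp

/-- The factor `a` from the marks cancels the factor `a⁻¹` from the times. -/
theorem map_shotNoiseIntensity {a : ℝ≥0} (ha : a ≠ 0) :
    (shotNoiseIntensity H).map (fun p => (a ^ H * p.1, a * p.2)) = shotNoiseIntensity H := by
  have := Measure.map_prod_map (markIntensity H) lebesgueHalfLine
    (f := fun y => a ^ H * y) (g := fun u => a * u) (by fun_prop) (by fun_prop)
  rw [map_mul_markIntensity hH ha, map_mul_lebesgueHalfLine ha] at this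
  rw [shotNoiseIntensity_eq]
  refine this.symm.trans ?_
  rw [Measure.prod_smul_left, Measure.prod_smul_right, smul_smul, mul_inv_cancel₀ ha, one_smul]

end MarkIntensity

/-! ### Almost sure properties of the shot times -/

section ShotNoisePoints

variable {Ω : Type*} [MeasurableSpace Ω] {P : Measure Ω} [IsProbabilityMeasure P] {H : ℝ}
  {η U : ℕ → Ω → ℝ≥0}

theorem ae_marks_pos
    (hN : IsPoissonPointProcess (fun i ω => (η i ω, U i ω)) (shotNoiseIntensity H) P) :
    ∀ᵐ ω ∂P, ∀ i, 0 < η i ω := by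
  have hA : MeasurableSet ({0} ×ˢ Set.univ : Set (ℝ≥0 × ℝ≥0)) :=
    (measurableSet_singleton 0).prod MeasurableSet.univ
  have h0 : shotNoiseIntensity H ({0} ×ˢ Set.univ) = 0 := by
    rw [shotNoiseIntensity_eq, Measure.prod_prod, markIntensity_singleton, zero_mul]
  filter_upwards [hN.ae_forall_notMem hA h0] with ω hω i
  refine pos_iff_ne_zero.2 fun h => hω i ?_
  simp [h]

-- Small marks have infinite total intensity, so every time slab of positive length has infinite
-- intensity. A countable dense set of endpoints gives one null set for all intervals.
omit [IsProbabilityMeasure P] in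
theorem ae_exists_time_mem_Ioc (hH : 0 < H)
    (hN : IsPoissonPointProcess (fun i ω => (η i ω, U i ω)) (shotNoiseIntensity H) P) :
    ∀ᵐ ω ∂P, ∀ a b : ℝ≥0, a < b → ∃ i, U i ω ∈ Set.Ioc a b := by
  have key : ∀ p q : ℝ≥0, p < q → ∀ᵐ ω ∂P, ∃ i, U i ω ∈ Set.Ioc p q := by
    intro p q hpq
    have hA : MeasurableSet (Set.univ ×ˢ Set.Ioc p q : Set (ℝ≥0 × ℝ≥0)) :=
      MeasurableSet.univ.prod measurableSet_Ioc
    have htop : shotNoiseIntensity H (Set.univ ×ˢ Set.Ioc p q) = ∞ := by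
      rw [shotNoiseIntensity_eq, Measure.prod_prod, markIntensity_univ hH, lebesgueHalfLine_Ioc,
        ENNReal.top_mul]
      simpa using hpq
    filter_upwards [hN.law_top _ hA htop] with ω hω
    by_contra! hcon
    have := (countingMeasure_eq_zero_iff (fun i ω => (η i ω, U i ω)) ω hA).2
      fun i hi => hcon i hi.2
    simp [this] at hω
  have key' : ∀ᵐ ω ∂P, ∀ k l : ℕ, TopologicalSpace.denseSeq ℝ≥0 k < TopologicalSpace.denseSeq ℝ≥0 l →
      ∃ i, U i ω ∈
        Set.Ioc (TopologicalSpace.denseSeq ℝ≥0 k) (TopologicalSpace.denseSeq ℝ≥0 l) := by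
    simp only [ae_all_iff]
    exact fun k l => key _ _
  filter_upwards [key'] with ω hω a b hab
  have hd := TopologicalSpace.denseRange_denseSeq ℝ≥0
  obtain ⟨_, ⟨k, rfl⟩, hak, hkb⟩ := Dense.exists_between hd hab
  obtain ⟨_, ⟨l, rfl⟩, hkl, hlb⟩ := Dense.exists_between hd hkb
  obtain ⟨i, hi⟩ := hω k l hkl
  exact ⟨i, hak.trans hi.1, hi.2.trans hlb.le⟩

/-- Cut `[0, R)` into `n * R` cells of length `1/n`. Simultaneous points share a cell, which for a
given cell has probability at most `(m / n) ^ 2`; the union bound `R * m ^ 2 / n` tends to 0. The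
threshold `ε` keeps `m` finite. -/
theorem measure_simultaneous_marks_eq_zero (hH : 0 < H)
    (hN : IsPoissonPointProcess (fun i ω => (η i ω, U i ω)) (shotNoiseIntensity H) P)
    {ε : ℝ≥0} (hε : 0 < ε) (R : ℕ) :
    P {ω | ∃ i j, i ≠ j ∧ ε < η i ω ∧ ε < η j ω ∧ U i ω = U j ω ∧ U i ω < R} = 0 := by
  set m := markIntensity H (Set.Ioi ε) with hm
  have hm' : m ≠ ∞ := by
    rw [hm, markIntensity_Ioi_of_pos hH hε]
    exact ENNReal.ofReal_ne_top
  set C : ℕ → ℕ → Set (ℝ≥0 × ℝ≥0) := fun n k =>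
    Set.Ioi ε ×ˢ Set.Ico ((k : ℝ≥0) / n) ((k + 1 : ℝ≥0) / n) with hC
  have hCm (n k : ℕ) : MeasurableSet (C n k) := measurableSet_Ioi.prod measurableSet_Ico
  have hCμ (n k : ℕ) (hn0 : n ≠ 0) : shotNoiseIntensity H (C n k) = m / n := by
    rw [hC, shotNoiseIntensity_eq, Measure.prod_prod, lebesgueHalfLine_Ico]
    have : (((k + 1 : ℝ≥0) / n : ℝ≥0) : ℝ) - (((k : ℝ≥0) / n : ℝ≥0) : ℝ) = (n : ℝ)⁻¹ := by
      push_cast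
      ring
    rw [this, div_eq_mul_inv]
    rw [ENNReal.ofReal_inv_of_pos (by positivity), ENNReal.ofReal_natCast]
  have bound (n : ℕ) (hn : n ≠ 0) :
      P {ω | ∃ i j, i ≠ j ∧ ε < η i ω ∧ ε < η j ω ∧ U i ω = U j ω ∧ U i ω < R} ≤
        (R * m ^ 2) / n := by
    have hn0 : (0 : ℝ≥0) < n := by exact_mod_cast Nat.pos_of_ne_zero hn
    calc _ ≤ P (⋃ k ∈ Finset.range (n * R),
          {ω | 2 ≤ countingMeasure (fun i ω => (η i ω, U i ω)) ω (C n k)}) := by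
          refine measure_mono ?_
          rintro ω ⟨i, j, hij, hi, hj, hU, hR⟩
          simp only [Set.mem_iUnion]
          have h1 : ((⌊n * U i ω⌋₊ : ℝ≥0) / n) ≤ U i ω := by
            rw [div_le_iff₀' hn0]
            exact Nat.floor_le (by positivity)
          have h2 : U i ω < ((⌊n * U i ω⌋₊ + 1 : ℝ≥0) / n) := by
            rw [lt_div_iff₀' hn0]
            exact Nat.lt_floor_add_one _
          refine ⟨⌊n * U i ω⌋₊, ?_, two_le_countingMeasure _ ω (hCm _ _) hij
            ⟨hi, h1, h2⟩ ⟨hj, ?_⟩⟩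
          · rw [Finset.mem_range, Nat.floor_lt (by positivity)]
            push_cast
            gcongr
          · rw [← hU]
            exact ⟨h1, h2⟩
      _ ≤ ∑ k ∈ Finset.range (n * R), (m / n) ^ 2 := by
          refine (measure_biUnion_finset_le _ _).trans (Finset.sum_le_sum fun k _ => ?_)
          rw [← hCμ n k hn]
          exact hN.measure_two_le (hCm n k)
      _ = (R * m ^ 2) / n := by
          have h1 : (n : ℝ≥0∞) ≠ 0 := by exact_mod_cast hn
          rw [Finset.sum_const, Finset.card_range, nsmul_eq_mul, Nat.cast_mul]
          simp only [div_eq_mul_inv]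
          calc (n : ℝ≥0∞) * R * (m * (n : ℝ≥0∞)⁻¹) ^ 2
              = (n * (n : ℝ≥0∞)⁻¹) * (R * m ^ 2 * (n : ℝ≥0∞)⁻¹) := by ring
            _ = _ := by rw [ENNReal.mul_inv_cancel h1 (ENNReal.natCast_ne_top n), one_mul]
  have hlim : Filter.Tendsto (fun n : ℕ => (R * m ^ 2) / (n : ℝ≥0∞)) Filter.atTop (nhds 0) := by
    have := ENNReal.Tendsto.const_div (a := R * m ^ 2) ENNReal.tendsto_nat_nhds_top
      (Or.inr (ENNReal.mul_ne_top (ENNReal.natCast_ne_top R) (ENNReal.pow_ne_top hm')))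
    simpa using this
  refine le_antisymm (ge_of_tendsto hlim ?_) zero_le
  filter_upwards [Filter.eventually_ne_atTop 0] with n hn using bound n hn

theorem ae_times_injective (hH : 0 < H)
    (hN : IsPoissonPointProcess (fun i ω => (η i ω, U i ω)) (shotNoiseIntensity H) P) :
    ∀ᵐ ω ∂P, Function.Injective fun i => U i ω := by
  have key : ∀ᵐ ω ∂P, ∀ l R : ℕ, ¬ ∃ i j, i ≠ j ∧ (l + 1 : ℝ≥0)⁻¹ < η i ω ∧
      (l + 1 : ℝ≥0)⁻¹ < η j ω ∧ U i ω = U j ω ∧ U i ω < R := by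
    simp only [ae_all_iff]
    intro l R
    simpa [ae_iff] using
      measure_simultaneous_marks_eq_zero hH hN (ε := (l + 1 : ℝ≥0)⁻¹) (by positivity) R
  filter_upwards [key, ae_marks_pos hN] with ω hω hpos i j hij
  by_contra hne
  obtain ⟨l, hl⟩ := exists_nat_one_div_lt (lt_min (hpos i) (hpos j))
  obtain ⟨R, hR⟩ := exists_nat_gt (U i ω)
  rw [one_div, lt_min_iff] at hl
  exact hω l R ⟨i, j, hne, hl.1, hl.2, hij, hR⟩

end ShotNoisePoints

/-! ### Jointly measurable evaluation of paths -/

section PathEvaluation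

open Filter Topology

/-- Evaluation of a path as the upper limit of its values at times `k / (n + 1)`. It is jointly
measurable, and it is the usual evaluation for continuous paths. -/
noncomputable def pathLimsup (b : ℝ≥0 → ℝ) (u : ℝ≥0) : ℝ :=
  limsup (fun n : ℕ => b ((⌊(u : ℝ) * (n + 1)⌋₊ : ℝ≥0) / (n + 1))) atTop

/-- Only countably many coordinates of the path are read, so the product σ-algebra on all paths
suffices. -/
theorem measurable_pathLimsup :
    Measurable fun p : (ℝ≥0 → ℝ) × ℝ≥0 => pathLimsup p.1 p.2 := by
  refine Measurable.limsup fun n => ?_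
  have h1 : Measurable fun q : (ℝ≥0 → ℝ) × ℕ => q.1 ((q.2 : ℝ≥0) / (n + 1)) :=
    measurable_from_prod_countable_left fun k =>
      (measurable_pi_apply ((k : ℝ≥0) / (n + 1)) : Measurable fun f : ℝ≥0 → ℝ => f _)
  have h2 : Measurable fun p : (ℝ≥0 → ℝ) × ℝ≥0 => (p.1, ⌊(p.2 : ℝ) * (n + 1)⌋₊) := by
    fun_prop
  exact h1.comp h2

theorem tendsto_floor_mul_div (u : ℝ≥0) :
    Tendsto (fun n : ℕ => (⌊(u : ℝ) * (n + 1)⌋₊ : ℝ≥0) / (n + 1)) atTop (𝓝 u) := by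
  have := (tendsto_nat_floor_mul_div_atTop (R := ℝ) u.coe_nonneg).comp
    (tendsto_natCast_atTop_atTop.comp (tendsto_add_atTop_nat 1))
  rw [← NNReal.tendsto_coe]
  refine this.congr fun n => ?_
  simp

theorem pathLimsup_eq {b : ℝ≥0 → ℝ} (hb : Continuous b) (u : ℝ≥0) : pathLimsup b u = b u :=
  ((hb.tendsto u).comp (tendsto_floor_mul_div u)).limsup_eq

end PathEvaluation

/-! ### Reduction of the supremum to the Poisson points -/

section MaxShotNoise

variable {Ω : Type*} {H κ : ℝ} {B : ℝ≥0 → Ω → ℝ} {η U : ℕ → Ω → ℝ≥0} {ω : Ω}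

theorem tsum_ite_time_eq (hinj : Function.Injective fun i => U i ω) (n : ℕ) :
    (∑' i, if U i ω = U n ω then (η i ω : ℝ≥0∞) else 0) = η n ω := by
  rw [tsum_eq_single n fun i hi => if_neg fun h => hi (hinj h), if_pos rfl]

theorem coe_add_coe_ofReal_mul (hκ : 0 < κ) (b : ℝ) (y : ℝ≥0) :
    (b : EReal) + ((ENNReal.ofReal (κ ^ H) * (y : ℝ≥0∞) : ℝ≥0∞) : EReal) =
      ((b + κ ^ H * y : ℝ) : EReal) := by
  rw [← ENNReal.ofReal_coe_nnreal, ← ENNReal.ofReal_mul (by positivity),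
    EReal.coe_ennreal_ofReal, max_eq_left (by positivity), EReal.coe_add]

/-- At a time `s > 0` without a shot, `B s` is a limit of values of `B` at shot times in `(a, s]`,
and nonnegative marks only raise these. Time 0 has no left neighbourhood, hence the separate
condition on `B 0`. -/
theorem maxShotNoise_le_iff (hκ : 0 < κ) (hB : Continuous fun t => B t ω)
    (hinj : Function.Injective fun i => U i ω)
    (hdense : ∀ a b : ℝ≥0, a < b → ∃ i, U i ω ∈ Set.Ioc a b) (t : ℝ≥0) (x : EReal) :
    maxShotNoise H κ B η U t ω ≤ x ↔ ((B 0 ω : ℝ) : EReal) ≤ x ∧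
      ∀ n, U n ω ≤ t → ((B (U n ω) ω + κ ^ H * η n ω : ℝ) : EReal) ≤ x := by
  have hle (b : ℝ) (z : ℝ≥0∞) : (b : EReal) ≤ (b : EReal) + (z : EReal) :=
    le_add_of_nonneg_right (EReal.coe_ennreal_nonneg z)
  simp only [maxShotNoise, iSup_le_iff]
  constructor
  · refine fun h => ⟨(hle _ _).trans (h 0 ⟨le_rfl, zero_le⟩), fun n hn => ?_⟩
    have := h (U n ω) ⟨zero_le, hn⟩
    rwa [tsum_ite_time_eq hinj, coe_add_coe_ofReal_mul hκ] at this
  · rintro ⟨h0, hU⟩ s ⟨-, hst⟩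
    by_cases hs : ∃ n, U n ω = s
    · obtain ⟨n, rfl⟩ := hs
      rw [tsum_ite_time_eq hinj, coe_add_coe_ofReal_mul hκ]
      exact hU n hst
    · push Not at hs
      simp only [hs, if_false, tsum_zero, mul_zero, EReal.coe_ennreal_zero, add_zero]
      rcases eq_or_ne s 0 with rfl | hs0
      · exact h0
      by_contra! hlt
      have hopen : {u | x < ((B u ω : ℝ) : EReal)} ∈ nhds s :=
        (isOpen_lt continuous_const (continuous_coe_real_ereal.comp hB)).mem_nhds hlt
      obtain ⟨a, ha, has⟩ := exists_Ioc_subset_of_mem_nhds hopen ⟨0, pos_iff_ne_zero.2 hs0⟩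
      obtain ⟨n, hn⟩ := hdense a s ha
      refine absurd (has hn) (not_lt.2 (le_trans ?_ (hU n (hn.2.trans hst))))
      rw [EReal.coe_le_coe_iff]
      have : 0 ≤ κ ^ H * η n ω := by positivity
      linarith

/-- This replaces an uncountable supremum by a countable one of measurable functions, which yields
`aemeasurable_maxShotNoise`. -/
theorem maxShotNoise_eq (hκ : 0 < κ) (hB : Continuous fun t => B t ω)
    (hinj : Function.Injective fun i => U i ω)
    (hdense : ∀ a b : ℝ≥0, a < b → ∃ i, U i ω ∈ Set.Ioc a b) (t : ℝ≥0) :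
    maxShotNoise H κ B η U t ω = max ((B 0 ω : ℝ) : EReal)
      (⨆ n, if U n ω ≤ t then
        ((pathLimsup (fun s => B s ω) (U n ω) + κ ^ H * η n ω : ℝ) : EReal) else ⊥) := by
  refine eq_of_forall_ge_iff fun x => ?_
  rw [maxShotNoise_le_iff hκ hB hinj hdense, max_le_iff, iSup_le_iff]
  simp only [pathLimsup_eq hB]
  refine and_congr_right fun _ => forall_congr' fun n => ?_
  split_ifs with h <;> simp [h]

theorem aemeasurable_maxShotNoise [MeasurableSpace Ω] {P : Measure Ω} (hκ : 0 < κ)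
    (hBm : ∀ t, Measurable (B t)) (hηm : ∀ i, Measurable (η i)) (hUm : ∀ i, Measurable (U i))
    (hB : ∀ᵐ ω ∂P, Continuous fun t => B t ω)
    (hinj : ∀ᵐ ω ∂P, Function.Injective fun i => U i ω)
    (hdense : ∀ᵐ ω ∂P, ∀ a b : ℝ≥0, a < b → ∃ i, U i ω ∈ Set.Ioc a b) (f : ℝ≥0 → ℝ≥0) :
    AEMeasurable (fun ω t => maxShotNoise H κ B η U (f t) ω) P := by
  refine ⟨fun ω t => max ((B 0 ω : ℝ) : EReal)
      (⨆ n, if U n ω ≤ f t then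
        ((pathLimsup (fun s => B s ω) (U n ω) + κ ^ H * η n ω : ℝ) : EReal) else ⊥), ?_, ?_⟩
  · have hX : Measurable fun ω s => B s ω := measurable_pi_lambda _ hBm
    have hY (n : ℕ) : Measurable fun ω => pathLimsup (fun s => B s ω) (U n ω) + κ ^ H * η n ω :=
      (measurable_pathLimsup.comp (hX.prodMk (hUm n))).add
        (measurable_const.mul (hηm n).coe_nnreal_real)
    refine measurable_pi_lambda _ fun t => Measurable.max (hBm 0).coe_real_ereal
      (Measurable.iSup fun n => Measurable.ite ?_ (hY n).coe_real_ereal measurable_const)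
    exact measurableSet_le (hUm n) measurable_const
  · filter_upwards [hB, hinj, hdense] with ω h1 h2 h3
    funext t
    exact maxShotNoise_eq hκ h1 h2 h3 _

end MaxShotNoise

/-! ### Identification of laws; scaling of fractional Brownian motion -/

theorem MeasureTheory.Measure.pi_ext_of_Iic {ι α : Type*} [Finite ι] [TopologicalSpace α]
    [SecondCountableTopology α] [LinearOrder α] [OrderTopology α] [OrderTop α] [MeasurableSpace α]
    [BorelSpace α] {μ ν : Measure (ι → α)} [IsFiniteMeasure μ]
    (h : ∀ x : ι → α, μ {z | ∀ i, z i ≤ x i} = ν {z | ∀ i, z i ≤ x i}) : μ = ν := by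
  have hset (x : ι → α) : Set.univ.pi (fun i => Set.Iic (x i)) = {z | ∀ i, z i ≤ x i} := by
    ext; simp [Pi.le_def]
  have hspan : IsCountablySpanning (Set.range (Set.Iic : α → Set α)) :=
    ⟨fun _ => Set.Iic ⊤, fun _ => ⟨⊤, rfl⟩, by simp [Set.iUnion_const]⟩
  have hgen : (MeasurableSpace.pi : MeasurableSpace (ι → α)) = MeasurableSpace.generateFrom
      (Set.univ.pi '' Set.univ.pi fun _ => Set.range (Set.Iic : α → Set α)) := by
    rw [← generateFrom_pi_eq fun _ => hspan, ← borel_eq_generateFrom_Iic,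
      ← BorelSpace.measurable_eq (α := α)]
  refine ext_of_generate_finite _ hgen (IsPiSystem.pi fun _ => isPiSystem_Iic) ?_ ?_
  · rintro _ ⟨s, hs, rfl⟩
    choose x hx using fun i => hs i (Set.mem_univ i)
    obtain rfl : (fun i => Set.Iic (x i)) = s := funext hx
    rw [hset, h]
  -- The box with all corners at `⊤` is the whole space, so the total masses agree.
  · simpa using h ⊤

/-- A Gaussian characteristic function depends only on the mean and variance of each linear
functional of finitely many coordinates; these expand into means and covariances of the coordinates.
-/
theorem IsGaussianProcess.identDistrib_of_integral_eq_of_covariance_eq {T Ω : Type*}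
    [MeasurableSpace Ω] {P : Measure Ω} {X Y : T → Ω → ℝ}
    (hX : IsGaussianProcess X P) (hY : IsGaussianProcess Y P)
    (hXm : ∀ t, Measurable (X t)) (hYm : ∀ t, Measurable (Y t))
    (hmean : ∀ t, ∫ ω, X t ω ∂P = ∫ ω, Y t ω ∂P)
    (hcov : ∀ s t, covariance (X s) (X t) P = covariance (Y s) (Y t) P) :
    IdentDistrib (fun ω t => X t ω) (fun ω t => Y t ω) P P := by
  classical
  have hP : IsProbabilityMeasure P := hX.isProbabilityMeasure
  have hXm' : Measurable fun ω t => X t ω := measurable_pi_lambda _ hXm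
  have hYm' : Measurable fun ω t => Y t ω := measurable_pi_lambda _ hYm
  refine ⟨hXm'.aemeasurable, hYm'.aemeasurable, ?_⟩
  rw [map_eq_iff_forall_finset_map_restrict_eq hXm'.aemeasurable hYm'.aemeasurable]
  intro I
  have := (hX.hasGaussianLaw I).isGaussian_map
  have := (hY.hasGaussianLaw I).isGaussian_map
  refine Measure.ext_of_charFunDual (funext fun L => ?_)
  have hL (Z : T → Ω → ℝ) : (fun ω => L (I.restrict fun t => Z t ω)) =
      fun ω => ∑ i : I, L (Pi.single i 1) * Z i ω := by
    funext ω
    conv_lhs => rw [pi_eq_sum_univ' (I.restrict fun t => Z t ω)]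
    simp [mul_comm]
  have hint (Z : T → Ω → ℝ) (hZ : IsGaussianProcess Z P) :
      ∫ ω, L (I.restrict fun t => Z t ω) ∂P = ∑ i : I, L (Pi.single i 1) * ∫ ω, Z i ω ∂P := by
    have hZi (i : I) : HasGaussianLaw (Z i) P := hZ.hasGaussianLaw_eval i
    rw [hL Z, integral_finsetSum _ fun i _ => (hZi i).integrable.const_mul _]
    simp_rw [integral_const_mul]
  have hvar (Z : T → Ω → ℝ) (hZ : IsGaussianProcess Z P) :
      variance (fun ω => L (I.restrict fun t => Z t ω)) P =
        ∑ i : I, ∑ j : I, L (Pi.single i 1) * (L (Pi.single j 1) * covariance (Z i) (Z j) P) := by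
    have hmem (i : I) : MemLp (fun ω => L (Pi.single i 1) * Z i ω) 2 P :=
      (hZ.hasGaussianLaw_eval (i : T)).memLp_two.const_mul _
    rw [hL Z, ← covariance_self
      (Finset.aemeasurable_fun_sum _ fun i _ => (hmem i).aestronglyMeasurable.aemeasurable), covariance_fun_sum_fun_sum hmem hmem]
    simp_rw [covariance_const_mul_left, covariance_const_mul_right]
  rw [(hX.hasGaussianLaw I).charFunDual_map_eq_fun, (hY.hasGaussianLaw I).charFunDual_map_eq_fun,
    hint X hX, hint Y hY, hvar X hX, hvar Y hY]
  simp_rw [hmean, hcov]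

theorem IsFractionalBrownianMotion.identDistrib_scale {Ω : Type*} [MeasurableSpace Ω] {H : ℝ}
    {B : ℝ≥0 → Ω → ℝ} {P : Measure Ω} (hB : IsFractionalBrownianMotion H B P) {a : ℝ≥0}
    (ha : 0 < a) :
    IdentDistrib (fun ω (t : ℝ≥0) => ((a : ℝ) ^ H)⁻¹ * B (a * t) ω) (fun ω t => B t ω) P P := by
  have ha' : (0 : ℝ) < a := ha
  refine IsGaussianProcess.identDistrib_of_integral_eq_of_covariance_eq
    (X := fun t ω => ((a : ℝ) ^ H)⁻¹ * B (a * t) ω)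
    ((hB.gaussian.comp_right fun t => a * t).smul fun _ => ((a : ℝ) ^ H)⁻¹) hB.gaussian
    (fun t => (hB.measurable _).const_mul _) hB.measurable (fun t => ?_) fun s t => ?_
  · rw [integral_const_mul, hB.centered, hB.centered, mul_zero]
  · rw [covariance_const_mul_left, covariance_const_mul_right, hB.cov, hB.cov, NNReal.coe_mul,
      NNReal.coe_mul, ← mul_sub, abs_mul, abs_of_pos ha', Real.mul_rpow ha'.le s.coe_nonneg,
      Real.mul_rpow ha'.le t.coe_nonneg, Real.mul_rpow ha'.le (abs_nonneg _)]
    have : (a : ℝ) ^ (2 * H) = (a : ℝ) ^ H * (a : ℝ) ^ H := by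
      rw [two_mul, Real.rpow_add ha']
    rw [this]
    field_simp

/-! ### The set of points that must be empty -/

section Exceedance

variable {ι : Type*}

/-- The pairs of a path `b` and a point `(y, u)` such that the noise `y` at time `u` lifts the path
above a level `x i` whose time `t i` is not before `u`. -/
def exceedanceSet (c : ℝ) (t : ι → ℝ≥0) (x : ι → EReal) :
    Set ((ℝ≥0 → ℝ) × (ℝ≥0 × ℝ≥0)) :=
  {p | ∃ i, p.2.2 ≤ t i ∧ x i < ((pathLimsup p.1 p.2.2 + c * p.2.1 : ℝ) : EReal)}

theorem measurableSet_exceedanceSet [Countable ι] (c : ℝ) (t : ι → ℝ≥0) (x : ι → EReal) :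
    MeasurableSet (exceedanceSet c t x) := by
  have h1 : Measurable fun p : (ℝ≥0 → ℝ) × (ℝ≥0 × ℝ≥0) =>
      pathLimsup p.1 p.2.2 + c * p.2.1 :=
    (measurable_pathLimsup.comp (measurable_fst.prodMk (measurable_snd.comp measurable_snd))).add
      (measurable_const.mul (measurable_fst.comp measurable_snd).coe_nnreal_real)
  have : exceedanceSet c t x = ⋃ i, {p : (ℝ≥0 → ℝ) × (ℝ≥0 × ℝ≥0) | p.2.2 ≤ t i} ∩
      {p | x i < ((pathLimsup p.1 p.2.2 + c * p.2.1 : ℝ) : EReal)} := by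
    ext p
    simp [exceedanceSet]
  rw [this]
  exact MeasurableSet.iUnion fun i =>
    (measurableSet_le (measurable_snd.comp measurable_snd) measurable_const).inter
      (measurableSet_lt measurable_const h1.coe_real_ereal)

theorem measurableSet_forall_start_le [Countable ι] (x : ι → EReal) :
    MeasurableSet {b : ℝ≥0 → ℝ | ∀ i, ((b 0 : ℝ) : EReal) ≤ x i} := by
  rw [Set.ofPred_forall]
  exact MeasurableSet.iInter fun i =>
    measurableSet_le (measurable_pi_apply 0).coe_real_ereal measurable_const

theorem EReal.coe_le_div_iff {r : ℝ} (hr : 0 < r) (z : EReal) (x : EReal) :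
    z ≤ x / (r : EReal) ↔ (r : EReal) * z ≤ x := by
  rw [EReal.le_div_iff_mul_le (by exact_mod_cast hr) (EReal.coe_ne_top r), mul_comm]

/-- Scaling the points of the shot noise amounts to scaling path, times and levels. -/
theorem shotNoiseIntensity_exceedanceSet_scale [Countable ι] {H : ℝ} (hH : 0 < H) {a : ℝ≥0}
    (ha : 0 < a) {b : ℝ≥0 → ℝ} (hb : Continuous b) (c : ℝ) (t : ι → ℝ≥0) (x : ι → EReal) :
    shotNoiseIntensity H (Prod.mk b ⁻¹' exceedanceSet c (fun i => a * t i) x) =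
      shotNoiseIntensity H (Prod.mk (fun s => ((a : ℝ) ^ H)⁻¹ * b (a * s)) ⁻¹'
        exceedanceSet c t fun i => x i / (((a : ℝ) ^ H : ℝ) : EReal)) := by
  have ha' : (0 : ℝ) < (a : ℝ) ^ H := Real.rpow_pos_of_pos ha H
  have hb' : Continuous fun s => ((a : ℝ) ^ H)⁻¹ * b (a * s) := by fun_prop
  conv_lhs => rw [← map_shotNoiseIntensity hH ha.ne']
  rw [Measure.map_apply (by fun_prop) (measurable_prodMk_left (measurableSet_exceedanceSet _ _ _))]
  congr 1
  ext ⟨y, u⟩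
  simp only [exceedanceSet, Set.mem_preimage, Set.mem_ofPred_eq, pathLimsup_eq hb,
    pathLimsup_eq hb', mul_le_mul_iff_right₀ ha]
  refine exists_congr fun i => and_congr_right fun _ => ?_
  rw [← not_le, ← not_le, EReal.coe_le_div_iff ha', ← EReal.coe_mul]
  have : (a : ℝ) ^ H * (((a : ℝ) ^ H)⁻¹ * b (a * u) + c * y) =
      b (a * u) + c * ((a ^ H * y : ℝ≥0) : ℝ) := by
    push_cast
    field_simp
  rw [this]

end Exceedance

/-! ### Joint distribution function as an expected void probability -/

section Law

variable {Ω ι : Type*} [MeasurableSpace Ω] {P : Measure Ω} [IsProbabilityMeasure P]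
  {H κ : ℝ} {B : ℝ≥0 → Ω → ℝ} {η U : ℕ → Ω → ℝ≥0}

omit [MeasurableSpace Ω] in
theorem countingMeasure_exceedanceSet_eq_zero_iff [Countable ι] {ω : Ω}
    (hB : Continuous fun t => B t ω) (c : ℝ) (t : ι → ℝ≥0) (x : ι → EReal) :
    countingMeasure (fun i ω => (η i ω, U i ω)) ω
        (Prod.mk (fun t => B t ω) ⁻¹' exceedanceSet c t x) = 0 ↔
      ∀ i n, U n ω ≤ t i → ((B (U n ω) ω + c * η n ω : ℝ) : EReal) ≤ x i := by
  rw [countingMeasure_eq_zero_iff _ _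
    (measurable_prodMk_left (measurableSet_exceedanceSet c t x)), forall_comm]
  simp [exceedanceSet, pathLimsup_eq hB]

variable (hH : 0 < H) (hκ : 0 < κ) (hBm : ∀ t, Measurable (B t))
    (hB : ∀ᵐ ω ∂P, Continuous fun t => B t ω)
    (hN : IsPoissonPointProcess (fun i ω => (η i ω, U i ω)) (shotNoiseIntensity H) P)
    (hindep : IndepFun (fun ω => countingMeasure (fun i ω => (η i ω, U i ω)) ω)
      (fun ω (t : ℝ≥0) => B t ω) P)
include hH hκ hBm hB hN hindep

/-- Times `t i = 0` are allowed, so the condition on `B 0` stays; self-similarity needs this form.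
-/
theorem measure_maxShotNoise_le [Countable ι] (t : ι → ℝ≥0) (x : ι → EReal) :
    P {ω | ∀ i, maxShotNoise H κ B η U (t i) ω ≤ x i} =
      ∫⁻ ω in (fun ω t => B t ω) ⁻¹' {b | ∀ i, ((b 0 : ℝ) : EReal) ≤ x i},
        EReal.exp (-(shotNoiseIntensity H
          (Prod.mk (fun t => B t ω) ⁻¹' exceedanceSet (κ ^ H) t x) : EReal)) ∂P := by
  rw [← hN.measure_random_set_eq_zero (measurable_pi_lambda _ hBm) hindep
    (measurableSet_exceedanceSet _ _ _) (measurableSet_forall_start_le x)]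
  refine measure_congr ?_
  filter_upwards [hB, ae_times_injective hH hN, ae_exists_time_mem_Ioc hH hN] with ω h1 h2 h3
  apply propext
  change (∀ i, _) ↔ (∀ i, _) ∧ _
  rw [countingMeasure_exceedanceSet_eq_zero_iff h1, ← forall_and]
  exact forall_congr' fun i => maxShotNoise_le_iff hκ h1 h2 h3 _ _

/-- For positive times the condition on `B 0` is redundant: shot times accumulate at 0 from the
right, so a violation at 0 would persist, by continuity, at some shot before `t i`. -/
theorem measure_maxShotNoise_le_of_pos [Countable ι] (t : ι → ℝ≥0) (ht : ∀ i, 0 < t i)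
    (x : ι → EReal) :
    P {ω | ∀ i, maxShotNoise H κ B η U (t i) ω ≤ x i} =
      ∫⁻ ω, EReal.exp (-(shotNoiseIntensity H
          (Prod.mk (fun t => B t ω) ⁻¹' exceedanceSet (κ ^ H) t x) : EReal)) ∂P := by
  have key := hN.measure_random_set_eq_zero (measurable_pi_lambda _ hBm) hindep
    (measurableSet_exceedanceSet (κ ^ H) t x) MeasurableSet.univ
  rw [Set.preimage_univ, setLIntegral_univ] at key
  rw [← key]
  refine measure_congr ?_
  filter_upwards [hB, ae_times_injective hH hN, ae_exists_time_mem_Ioc hH hN] with ω h1 h2 h3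
  apply propext
  change (∀ i, _) ↔ _ ∧ _
  rw [countingMeasure_exceedanceSet_eq_zero_iff h1]
  simp only [Set.mem_univ, true_and]
  refine forall_congr' fun i => (maxShotNoise_le_iff hκ h1 h2 h3 _ _).trans
    ⟨fun h => h.2, fun h => ⟨?_, h⟩⟩
  by_contra! hlt
  have hopen : {u | x i < ((B u ω : ℝ) : EReal)} ∈ nhds (0 : ℝ≥0) :=
    (isOpen_lt continuous_const (continuous_coe_real_ereal.comp h1)).mem_nhds hlt
  obtain ⟨b, hb, hsub⟩ := exists_Ico_subset_of_mem_nhds hopen ⟨1, one_pos⟩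
  obtain ⟨b', hb', hbb'⟩ := exists_between (lt_min hb (ht i))
  obtain ⟨n, hn⟩ := h3 0 b' hb'
  rw [lt_min_iff] at hbb'
  refine absurd (hsub ⟨zero_le, hn.2.trans_lt hbb'.1⟩)
    (not_lt.2 (le_trans ?_ (h n (hn.2.trans hbb'.2.le))))
  rw [EReal.coe_le_coe_iff]
  have : 0 ≤ κ ^ H * η n ω := by positivity
  linarith

end Law

/-! ### Explicit value of the exponent -/

section Formula

variable {H κ : ℝ} (hH : 0 < H) (hκ : 0 < κ)
include hH hκ

theorem markIntensity_setOf_lt (m g : ℝ) :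
    markIntensity H {y : ℝ≥0 | m < g + κ ^ H * y} =
      ENNReal.ofReal κ / ENNReal.ofReal (m - g) ^ (1 / H) := by
  have hc : 0 < κ ^ H := Real.rpow_pos_of_pos hκ H
  have hH' : 0 < 1 / H := by positivity
  rcases lt_or_ge m g with h | h
  · have : {y : ℝ≥0 | m < g + κ ^ H * y} = Set.univ := by
      refine Set.eq_univ_of_forall fun y => ?_
      have : 0 ≤ κ ^ H * y := by positivity
      simp only [Set.mem_ofPred_eq]
      linarith
    rw [this, markIntensity_univ hH, ENNReal.ofReal_of_nonpos (p := m - g) (by linarith),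
      ENNReal.zero_rpow_of_pos hH', ENNReal.div_zero (by simpa using hκ)]
  · have hset : {y : ℝ≥0 | m < g + κ ^ H * y} = Set.Ioi ((m - g) / κ ^ H).toNNReal := by
      ext y
      rw [Set.mem_ofPred_eq, Set.mem_Ioi, Real.toNNReal_lt_iff_lt_coe
        (div_nonneg (by linarith) hc.le), div_lt_iff₀' hc]
      constructor <;> intro <;> linarith
    rw [hset, markIntensity_Ioi hH]
    change 1 / ENNReal.ofReal _ ^ _ = _
    rw [ENNReal.ofReal_div_of_pos hc, ENNReal.div_rpow_of_nonneg _ _ hH'.le,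
      ← ENNReal.ofReal_rpow_of_pos hκ, ← ENNReal.rpow_mul, mul_one_div_cancel hH.ne',
      ENNReal.rpow_one, one_div, ENNReal.inv_div]
    · simp
    · left
      simpa using hκ

/-- Slice at time `u` by Fubini. For `u` in the `q`-th interval exactly the levels `x j` with `j ≥
q` are active, so a mark exceeds one of them iff it exceeds their minimum; beyond the last time the
slice is empty. -/
theorem shotNoiseIntensity_exceedanceSet {d : ℕ} {t : Fin (d + 1) → ℝ≥0} (x : Fin d → ℝ)
    (ht0 : t 0 = 0) (ht : StrictMono t) {b : ℝ≥0 → ℝ} (hb : Continuous b) :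
    shotNoiseIntensity H (Prod.mk b ⁻¹' exceedanceSet (κ ^ H) (fun q => t (Fin.succ q))
        fun q => (x q : EReal)) =
      ∑ q : Fin d, ∫⁻ s in Set.Ioc (t q.castSucc) (t q.succ),
          ENNReal.ofReal κ /
            ENNReal.ofReal ((Finset.Ici q).inf' Finset.nonempty_Ici x - b s) ^ (1 / H)
              ∂lebesgueHalfLine := by
  set f : Fin d → ℝ≥0 → ℝ≥0∞ := fun q s => ENNReal.ofReal κ /
    ENNReal.ofReal ((Finset.Ici q).inf' Finset.nonempty_Ici x - b s) ^ (1 / H) with hf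
  have hfm (q : Fin d) : Measurable (f q) := by
    have := hb.measurable
    fun_prop
  rw [shotNoiseIntensity_eq, Measure.prod_apply_symm
    (measurable_prodMk_left (measurableSet_exceedanceSet _ _ _))]
  simp_rw [← lintegral_indicator measurableSet_Ioc]
  rw [← lintegral_finsetSum _ fun q _ => (hfm q).indicator measurableSet_Ioc]
  -- Time 0 lies in none of the half-open intervals although every level is active there.
  have h0 : ∀ᵐ u ∂lebesgueHalfLine, u ≠ 0 := by
    simpa [ae_iff] using lebesgueHalfLine_singleton 0
  refine lintegral_congr_ae ?_
  filter_upwards [h0] with u hu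
  have hsec : (fun y => (y, u)) ⁻¹' (Prod.mk b ⁻¹' exceedanceSet (κ ^ H)
      (fun q : Fin d => t q.succ) fun q => (x q : EReal)) =
      {y : ℝ≥0 | ∃ q : Fin d, u ≤ t q.succ ∧ x q < b u + κ ^ H * y} := by
    ext y
    rw [Set.mem_preimage, Set.mem_preimage]
    simp only [exceedanceSet, Set.mem_ofPred_eq, pathLimsup_eq hb, EReal.coe_lt_coe_iff]
  rw [hsec]
  by_cases hex : ∃ q : Fin d, u ∈ Set.Ioc (t q.castSucc) (t q.succ)
  · obtain ⟨q, hq⟩ := hex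
    have hiff (j : Fin d) : u ≤ t j.succ ↔ q ≤ j := by
      constructor
      · intro h
        have : t q.castSucc < t j.succ := hq.1.trans_le h
        exact Fin.castSucc_lt_succ_iff.1 (ht.lt_iff_lt.1 this)
      · intro h
        exact hq.2.trans (ht.monotone (Fin.succ_le_succ_iff.2 h))
    rw [Finset.sum_eq_single q]
    · rw [Set.indicator_of_mem hq, hf]
      simp only
      rw [← markIntensity_setOf_lt hH hκ]
      congr 1
      ext y
      simp [hiff, Finset.inf'_lt_iff]
    · intro j _ hj
      refine Set.indicator_of_notMem (fun hju => hj ?_) _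
      refine le_antisymm ?_ ((hiff j).1 hju.2)
      have : t j.castSucc < t q.succ := hju.1.trans_le hq.2
      exact Fin.castSucc_lt_succ_iff.1 (ht.lt_iff_lt.1 this)
    · simp
  · have hlast : ∀ q : Fin (d + 1), t q < u := by
      intro q
      induction q using Fin.induction with
      | zero => rw [ht0]; exact pos_iff_ne_zero.2 hu
      | succ q ih => exact lt_of_not_ge fun h => hex ⟨q, ih, h⟩
    rw [Finset.sum_eq_zero fun q _ => Set.indicator_of_notMem (fun h => hex ⟨q, h⟩) _]
    refine measure_mono_null (t := ∅) ?_ measure_empty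
    rintro y ⟨q, hq, -⟩
    exact absurd (hlast q.succ) (not_lt.2 hq)

end Formula

/-! ### Self-similarity -/

section SelfSimilarity

variable {Ω : Type*} [MeasurableSpace Ω] {P : Measure Ω} [IsProbabilityMeasure P]
  {H κ : ℝ} {B : ℝ≥0 → Ω → ℝ} {η U : ℕ → Ω → ℝ≥0}
  (hH : 0 < H) (hκ : 0 < κ) (hB : IsFractionalBrownianMotion H B P)
  (hN : IsPoissonPointProcess (fun i ω => (η i ω, U i ω)) (shotNoiseIntensity H) P)
  (hindep : IndepFun (fun ω => countingMeasure (fun i ω => (η i ω, U i ω)) ω)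
    (fun ω (t : ℝ≥0) => B t ω) P)
include hH hκ hB hN hindep

theorem measure_maxShotNoise_scale {ι : Type*} [Countable ι] {a : ℝ≥0} (ha : 0 < a)
    (t : ι → ℝ≥0) (x : ι → EReal) :
    P {ω | ∀ i, maxShotNoise H κ B η U (a * t i) ω ≤ x i} =
      P {ω | ∀ i, (((a : ℝ) ^ H : ℝ) : EReal) * maxShotNoise H κ B η U (t i) ω ≤ x i} := by
  have ha' : (0 : ℝ) < (a : ℝ) ^ H := Real.rpow_pos_of_pos ha H
  simp_rw [← EReal.coe_le_div_iff ha']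
  rw [measure_maxShotNoise_le hH hκ hB.measurable hB.continuous_paths hN hindep,
    measure_maxShotNoise_le hH hκ hB.measurable hB.continuous_paths hN hindep]
  set x' : ι → EReal := fun i => x i / (((a : ℝ) ^ H : ℝ) : EReal) with hx'
  -- `Φ` is the conditional probability as a function of the path. Its integral is the same for `B`
  -- and the rescaled path, and evaluating it on the latter gives the integrand at times `a * t i`.
  set Φ : (ℝ≥0 → ℝ) → ℝ≥0∞ := {b | ∀ i, ((b 0 : ℝ) : EReal) ≤ x' i}.indicator fun b =>
    EReal.exp (-(shotNoiseIntensity H (Prod.mk b ⁻¹' exceedanceSet (κ ^ H) t x') : EReal)) with hΦ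
  have hΦm : Measurable Φ := by
    refine Measurable.indicator ?_ (measurableSet_forall_start_le x')
    have := measurable_measure_prodMk_left (ν := shotNoiseIntensity H)
      (measurableSet_exceedanceSet (κ ^ H) t x')
    fun_prop
  have hBm : Measurable fun ω (t : ℝ≥0) => B t ω := measurable_pi_lambda _ hB.measurable
  have hid := ((hB.identDistrib_scale ha).comp hΦm).lintegral_eq
  rw [← lintegral_indicator (hBm (measurableSet_forall_start_le _)),
    ← lintegral_indicator (hBm (measurableSet_forall_start_le _))]
  refine Eq.trans (lintegral_congr_ae ?_) hid
  filter_upwards [hB.continuous_paths] with ω hω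
  have hiff : (∀ i, ((B 0 ω : ℝ) : EReal) ≤ x i) ↔
      ∀ i, ((((a : ℝ) ^ H)⁻¹ * B (a * 0) ω : ℝ) : EReal) ≤ x' i := by
    refine forall_congr' fun i => ?_
    rw [hx', EReal.coe_le_div_iff ha', ← EReal.coe_mul, mul_inv_cancel_left₀ ha'.ne', mul_zero]
  rw [Function.comp_apply, hΦ]
  by_cases h : ∀ i, ((B 0 ω : ℝ) : EReal) ≤ x i
  · rw [Set.indicator_of_mem (by exact h), Set.indicator_of_mem (by exact hiff.1 h),
      shotNoiseIntensity_exceedanceSet_scale hH ha hω]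
  · rw [Set.indicator_of_notMem (by exact h), Set.indicator_of_notMem (by exact mt hiff.2 h)]

theorem identDistrib_maxShotNoise_scale {a : ℝ≥0} (ha : 0 < a) :
    IdentDistrib (fun ω (t : ℝ≥0) => maxShotNoise H κ B η U (a * t) ω)
      (fun ω (t : ℝ≥0) => (((a : ℝ) ^ H : ℝ) : EReal) * maxShotNoise H κ B η U t ω) P P := by
  have hηm (i : ℕ) : Measurable (η i) := measurable_fst.comp (hN.measurable i)
  have hUm (i : ℕ) : Measurable (U i) := measurable_snd.comp (hN.measurable i)
  have hZ (f : ℝ≥0 → ℝ≥0) := aemeasurable_maxShotNoise (P := P) (H := H) hκ hB.measurable hηm hUm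
    hB.continuous_paths (ae_times_injective hH hN) (ae_exists_time_mem_Ioc hH hN) f
  have hm : Measurable fun (z : ℝ≥0 → EReal) t => (((a : ℝ) ^ H : ℝ) : EReal) * z t := by
    refine measurable_pi_lambda _ fun t => ?_
    have := measurable_pi_apply (X := fun _ : ℝ≥0 => EReal) t
    fun_prop
  have hZ' := hm.comp_aemeasurable (hZ id)
  refine ⟨hZ _, hZ', ?_⟩
  rw [map_eq_iff_forall_finset_map_restrict_eq (X := fun t ω => maxShotNoise H κ B η U (a * t) ω)
    (Y := fun t ω => (((a : ℝ) ^ H : ℝ) : EReal) * maxShotNoise H κ B η U t ω) (hZ _) hZ']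
  intro I
  have hr : Measurable fun z : ℝ≥0 → EReal => I.restrict z := Finset.measurable_restrict I
  have := Measure.isFiniteMeasure_map P
    (fun ω => I.restrict fun t => maxShotNoise H κ B η U (a * t) ω)
  refine Measure.pi_ext_of_Iic fun x => ?_
  have hS : MeasurableSet {z : I → EReal | ∀ i, z i ≤ x i} := measurableSet_Iic
  have h1 : AEMeasurable (fun ω => I.restrict fun t => maxShotNoise H κ B η U (a * t) ω) P :=
    hr.comp_aemeasurable (hZ fun t => a * t)
  have h2 : AEMeasurable (fun ω => I.restrict fun t =>
      (((a : ℝ) ^ H : ℝ) : EReal) * maxShotNoise H κ B η U t ω) P := hr.comp_aemeasurable hZ'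
  rw [Measure.map_apply_of_aemeasurable h1 hS, Measure.map_apply_of_aemeasurable h2 hS]
  exact measure_maxShotNoise_scale hH hκ hB hN hindep ha (fun i : I => (i : ℝ≥0)) x

end SelfSimilarity

theorem proposition1 {Ω : Type*} [MeasurableSpace Ω] (P : Measure Ω) [IsProbabilityMeasure P]
    (H κ : ℝ) (hH0 : 0 < H) (hH1 : H < 1) (hκ : 0 < κ)
    (B : ℝ≥0 → Ω → ℝ) (hB : IsFractionalBrownianMotion H B P)
    (η U : ℕ → Ω → ℝ≥0)
    (hN : IsPoissonPointProcess (fun i ω => (η i ω, U i ω)) (shotNoiseIntensity H) P)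
    (hindep : IndepFun (fun ω => countingMeasure (fun i ω => (η i ω, U i ω)) ω)
      (fun ω (t : ℝ≥0) => B t ω) P) :
    (∀ (d : ℕ) (t : Fin (d + 1) → ℝ≥0) (x : Fin d → ℝ), t 0 = 0 → StrictMono t →
      P {ω | ∀ q : Fin d, maxShotNoise H κ B η U (t q.succ) ω ≤ ((x q : ℝ) : EReal)} =
        ∫⁻ ω, EReal.exp (-((∑ q : Fin d, ∫⁻ s in Set.Ioc (t q.castSucc) (t q.succ),
          ENNReal.ofReal κ /
            ENNReal.ofReal ((Finset.Ici q).inf' Finset.nonempty_Ici x - B s ω) ^ (1 / H)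
              ∂lebesgueHalfLine : ℝ≥0∞) :
              EReal)) ∂P) ∧
    (∀ a : ℝ≥0, 0 < a →
      IdentDistrib (fun ω (t : ℝ≥0) => maxShotNoise H κ B η U (a * t) ω)
        (fun ω (t : ℝ≥0) => (((a : ℝ) ^ H : ℝ) : EReal) * maxShotNoise H κ B η U t ω) P P) := by

  refine ⟨fun d t x ht0 ht => ?_, fun a ha =>
    identDistrib_maxShotNoise_scale hH0 hκ hB hN hindep ha⟩
  refine (measure_maxShotNoise_le_of_pos hH0 hκ hB.measurable hB.continuous_paths hN hindep
    (fun q : Fin d => t q.succ) (fun q => ?_) fun q => ((x q : ℝ) : EReal)).trans ?_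
  · rw [← ht0]
    exact ht (Fin.succ_pos q)
  · refine lintegral_congr_ae ?_
    filter_upwards [hB.continuous_paths] with ω hω
    rw [shotNoiseIntensity_exceedanceSet hH0 hκ x ht0 ht hω]
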